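/- Fix a countably infinite universe $\mathbf{dom}$ of data elements and a countable set $\mathbb V$ of variables; a valuation is a function $\nu:\mathbb V\to\mathbf{dom}$. A vocabulary $\mathcal S$ is a nonempty set of module names, each name $M$ having an arity $\mathrm{ar}(M)$ and an input arity $\mathrm{iar}(M)\le \mathrm{ar}(M)$. An interpretation $D$ of $\mathcal S$ assigns to each $M$ a relation $D(M)\subseteq\mathbf{dom}^{\mathrm{ar}(M)}$. LIF expressions over $\mathcal S$ are given by $$\alpha ::= \mathit{id}\mid M(\bar x;\bar y)\mid \alpha\cup\alpha\mid\alpha\cap\alpha\mid\alpha\setminus\alpha\mid\alpha\mathbin{;}\alpha\mid \mathrm{cyl}^{l}_{Z}(\alpha)\mid \mathrm{cyl}^{r}_{Z}(\alpha)\mid \sigma^{lr}_{x=y}(\alpha)\mid\sigma^{l}_{x=y}(\alpha)\mid\sigma^{r}_{x=y}(\alpha),$$ where $M$ is a module name, $\bar x,\bar y$ are tuples of variables of lengths $\mathrm{iar}(M)$ and $\mathrm{ar}(M)-\mathrm{iar}(M)$, $Z$ is a finite set of variables, and $x,y$ are variables. The semantics $[\![\alpha]\!]_D$ is a binary relation on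 valuations: $[\![\mathit{id}]\!]_D$ is the identity relation; $(\nu_1,\nu_2)\in[\![M(\bar x;\bar y)]\!]_D$ iff $\nu_1(\bar x)\cdot\nu_2(\bar y)\in D(M)$ and $\nu_1,\nu_2$ agree on all variables not in $\bar y$; $\cup,\cap,\setminus,\mathbin{;}$ are union, intersection, difference and relational composition; $\mathrm{cyl}^{l}_{Z}(A)$ (resp. $\mathrm{cyl}^{r}_{Z}(A)$) consists of all pairs that become a member of $A$ after possibly changing the values of variables in $Z$ in the left (resp. right) valuation; $\sigma^{lr}_{x=y},\sigma^{l}_{x=y},\sigma^{r}_{x=y}$ select the pairs with $\nu_1(x)=\nu_2(y)$, $\nu_1(x)=\nu_1(y)$, $\nu_2(x)=\nu_2(y)$, respectively. An expression $\alpha$ is satisfiable if $[\![\alpha]\!]_D\ne\emptyset$ for some interpretation $D$. Expressions are presented to algorithms by Gödel numbers, relative to any fixed injective numberings of the module names and of the variables. The satisfiability problem (given a LIF expression $\alpha$ over $\mathcal S$, is $\alpha$ satisfiable?) is undecidable, i.e. there is no total computable function that answers it correctly for all $\alpha$, in each of the following cases: 1. $\mathbb V\neq\emptyset$ and, for all $0\le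 i\le a$, $\mathcal S$ contains infinitely many module names of arity $a$ and input arity $i$; 2. $\mathbb V$ has at least two elements and, for every $a\ge 0$, $\mathcal S$ contains infinitely many module names of arity $a$ (with arbitrary input arities, for example all equal to $0$). -/

import Mathlib

universe u v w

namespace LIF

/-- A module vocabulary: a nonempty set of module names, each with an arity and an input arity
that is at most the arity. -/
structure Vocabulary where
  Names : Type u
  nonempty : Nonempty Names
  arity : Names → ℕ
  iar : Names → ℕ
  iar_le_arity : ∀ M, iar M ≤ arity M

/-- An interpretation over the universe `dom` of data elements assigns to each module name a
relation over `dom` of the right arity. -/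
def Interpretation (S : Vocabulary.{u}) (dom : Type w) : Type (max u w) :=
  (M : S.Names) → Set (Fin (S.arity M) → dom)

/-- Valuations of the variables `V` in the universe `dom`. -/
abbrev Valuation (V : Type v) (dom : Type w) : Type (max v w) := V → dom

/-- Two valuations agree outside the set `Y` of variables. -/
def AgreeOutside {V : Type v} {dom : Type w} (ν₁ ν₂ : Valuation V dom) (Y : Set V) : Prop :=
  ∀ y, y ∉ Y → ν₁ y = ν₂ y

/-- Binary relations on valuations. -/
abbrev BRV (V : Type v) (dom : Type w) : Type (max v w) :=
  Set (Valuation V dom × Valuation V dom)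

namespace BRV

variable {V : Type v} {dom : Type w}

/-- Composition of binary relations on valuations. -/
def comp (A B : BRV V dom) : BRV V dom :=
  {p | ∃ ν₃, (p.1, ν₃) ∈ A ∧ (ν₃, p.2) ∈ B}

/-- Left cylindrification. -/
def cylL (Z : Finset V) (A : BRV V dom) : BRV V dom :=
  {p | ∃ ν₁', (ν₁', p.2) ∈ A ∧ AgreeOutside ν₁' p.1 (Z : Set V)}

/-- Right cylindrification. -/
def cylR (Z : Finset V) (A : BRV V dom) : BRV V dom :=
  {p | ∃ ν₂', (p.1, ν₂') ∈ A ∧ AgreeOutside ν₂' p.2 (Z : Set V)}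

/-- Left selection. -/
def selL (x y : V) (A : BRV V dom) : BRV V dom :=
  {p | p ∈ A ∧ p.1 x = p.1 y}

/-- Right selection. -/
def selR (x y : V) (A : BRV V dom) : BRV V dom :=
  {p | p ∈ A ∧ p.2 x = p.2 y}

/-- Left-to-right selection. -/
def selLR (x y : V) (A : BRV V dom) : BRV V dom :=
  {p | p ∈ A ∧ p.1 x = p.2 y}

end BRV

/-- LIF expressions over the vocabulary `S` with variables from `V`. -/
inductive Expr (S : Vocabulary.{u}) (V : Type v) : Type (max u v) where
  | id : Expr S V
  | atom (M : S.Names) (z : Fin (S.arity M) → V) : Expr S V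
  | union (α β : Expr S V) : Expr S V
  | inter (α β : Expr S V) : Expr S V
  | diff (α β : Expr S V) : Expr S V
  | comp (α β : Expr S V) : Expr S V
  | cylL (Z : Finset V) (α : Expr S V) : Expr S V
  | cylR (Z : Finset V) (α : Expr S V) : Expr S V
  | selLR (x y : V) (α : Expr S V) : Expr S V
  | selL (x y : V) (α : Expr S V) : Expr S V
  | selR (x y : V) (α : Expr S V) : Expr S V

namespace Expr

variable {S : Vocabulary.{u}} {V : Type v} {dom : Type w}

/-- The semantics of an atomic module expression: the first `iar M` arguments are read in the
left valuation, the remaining (output) arguments in the right valuation, and all variables that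
are not outputs keep their value. -/
def atomSem (D : Interpretation S dom) (M : S.Names) (z : Fin (S.arity M) → V) : BRV V dom :=
  {p | (fun i : Fin (S.arity M) => if (i : ℕ) < S.iar M then p.1 (z i) else p.2 (z i)) ∈ D M ∧
    AgreeOutside p.1 p.2 {y | ∃ i : Fin (S.arity M), S.iar M ≤ (i : ℕ) ∧ z i = y}}

/-- The semantics of a LIF expression under an interpretation. -/
def sem (D : Interpretation S dom) : Expr S V → BRV V dom
  | id => {p | p.1 = p.2}
  | atom M z => atomSem D M z
  | union α β => sem D α ∪ sem D β
  | inter α β => sem D α ∩ sem D β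
  | diff α β => sem D α \ sem D β
  | comp α β => BRV.comp (sem D α) (sem D β)
  | cylL Z α => BRV.cylL Z (sem D α)
  | cylR Z α => BRV.cylR Z (sem D α)
  | selLR x y α => BRV.selLR x y (sem D α)
  | selL x y α => BRV.selL x y (sem D α)
  | selR x y α => BRV.selR x y (sem D α)

/-- An expression is satisfiable (over the universe `dom`) if its semantics is nonempty under
some interpretation. -/
def Satisfiable (dom : Type w) (α : Expr S V) : Prop :=
  ∃ D : Interpretation S dom, (α.sem D).Nonempty

/-- The Gödel number of an expression, relative to numberings of the module names and of the
variables: a tag for the outermost constructor, paired with the codes of its arguments. -/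
def code [Encodable S.Names] [Encodable V] : Expr S V → ℕ
  | id => Nat.pair 0 0
  | atom M z => Nat.pair 1 (Nat.pair (Encodable.encode M) (Encodable.encode (List.ofFn z)))
  | union α β => Nat.pair 2 (Nat.pair α.code β.code)
  | inter α β => Nat.pair 3 (Nat.pair α.code β.code)
  | diff α β => Nat.pair 4 (Nat.pair α.code β.code)
  | comp α β => Nat.pair 5 (Nat.pair α.code β.code)
  | cylL Z α => Nat.pair 6 (Nat.pair (Encodable.encode Z) α.code)
  | cylR Z α => Nat.pair 7 (Nat.pair (Encodable.encode Z) α.code)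
  | selLR x y α =>
      Nat.pair 8 (Nat.pair (Nat.pair (Encodable.encode x) (Encodable.encode y)) α.code)
  | selL x y α =>
      Nat.pair 9 (Nat.pair (Nat.pair (Encodable.encode x) (Encodable.encode y)) α.code)
  | selR x y α =>
      Nat.pair 10 (Nat.pair (Nat.pair (Encodable.encode x) (Encodable.encode y)) α.code)

/-- Distinct expressions have distinct Gödel numbers. -/
theorem code_injective [Encodable S.Names] [Encodable V] :
    Function.Injective (code : Expr S V → ℕ) := by
  intro α
  induction α with
  | atom M z =>
    intro β h
    cases β <;> simp only [code, Nat.pair_eq_pair, Encodable.encode_inj] at h <;> try omega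
    obtain ⟨-, rfl, h⟩ := h
    rw [List.ofFn_injective h]
  | _ =>
    intro β h
    cases β <;> simp only [code, Nat.pair_eq_pair, Encodable.encode_inj] at h <;> grind

end Expr

/-- The satisfiability problem for LIF expressions over `S`, with variables `V` and universe `dom`,
is decidable: some total computable function, given the Gödel number of any expression, tells
whether the expression is satisfiable. -/
def SatisfiabilityDecidable (dom : Type w) (S : Vocabulary.{u}) (V : Type v)
    [Encodable S.Names] [Encodable V] : Prop :=
  ∃ f : ℕ → Bool, Computable f ∧ ∀ α : Expr S V, f α.code = true ↔ α.Satisfiable dom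

end LIF

/-! Non-halting reduces to satisfiability. The calculus of relations, without converse but with
difference and the full relation, can assert that an axiom has no violation anywhere: a violation
term `v` is empty iff `top ; v ; top` is empty. Over a relation symbol for each program graph and
symbols for tree structure, the term `diverges c n` says that a leaf exists, pairs can be formed,
the graphs are closed under the evaluation rules, and `c` has no value on `n`. Every model contains
a possibly non-injective image of the binary trees. The rules are Horn clauses, so all true
evaluations hold in that image; hence a model excludes halting (`not_dom_of_sem_diverges`).
Conversely, if `c` diverges, the trees with least graphs are a model (`treeModel_diverges`),
transferred to `dom` by a bijection. LIF simulates this calculus by storing each point as the value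
of one variable (`RelTerm.sem_toExpr`). It remains to express arbitrary binary relations by modules,
which is where the two cases differ, and to compute Gödel numbers in `n`. -/

open Turing.ToPartrec

namespace LIF

/-! ### Binary trees and the evaluation of codes on them -/

/-- Unlabelled binary trees. -/
inductive BinTree : Type
  | leaf : BinTree
  | node (a b : BinTree) : BinTree

namespace BinTree

/-- The left subtree, with default `leaf`. -/
def left : BinTree → BinTree
  | leaf => leaf
  | node a _ => a

/-- The right subtree, with default `leaf`. -/
def right : BinTree → BinTree
  | leaf => leaf
  | node _ b => b

/-- An injective numbering of the binary trees. -/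
def toNat : BinTree → ℕ
  | leaf => 0
  | node a b => Nat.pair a.toNat b.toNat + 1

theorem toNat_injective : Function.Injective toNat := by
  intro a
  induction a with
  | leaf => intro b h; cases b <;> simp [toNat] at h ⊢
  | node a₁ a₂ ih₁ ih₂ =>
    intro b h
    cases b with
    | leaf => simp [toNat] at h
    | node b₁ b₂ =>
      simp only [toNat, Nat.add_right_cancel_iff, Nat.pair_eq_pair] at h
      rw [ih₁ h.1, ih₂ h.2]

instance : Countable BinTree := toNat_injective.countable

/-- The tree of a natural number. -/
def ofNat : ℕ → BinTree
  | 0 => leaf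
  | n + 1 => node leaf (ofNat n)

/-- The tree of a list of natural numbers. -/
def ofList : List ℕ → BinTree
  | [] => leaf
  | n :: l => node (ofNat n) (ofList l)

theorem ofNat_injective : Function.Injective ofNat := by
  intro m
  induction m with
  | zero => intro n h; cases n <;> simp [ofNat] at h ⊢
  | succ m ih =>
    intro n h
    cases n with
    | zero => simp [ofNat] at h
    | succ n =>
      simp only [ofNat, node.injEq, true_and] at h
      rw [ih h]

instance : Infinite BinTree := Infinite.of_injective ofNat ofNat_injective

theorem left_ofList (l : List ℕ) : (ofList l).left = ofNat l.headI := by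
  cases l <;> rfl

theorem right_ofList (l : List ℕ) : (ofList l).right = ofList l.tail := by
  cases l <;> rfl

end BinTree

open BinTree

/-- Evaluation of codes on binary trees. -/
inductive EvalsTo : Code → BinTree → BinTree → Prop
  | zero' (a : BinTree) : EvalsTo .zero' a (node leaf a)
  | succ (a : BinTree) : EvalsTo .succ a (node (node leaf a.left) leaf)
  | tail (a : BinTree) : EvalsTo .tail a a.right
  | cons {f g : Code} {a b c : BinTree} : EvalsTo f a b → EvalsTo g a c →
      EvalsTo (.cons f g) a (node b.left c)
  | comp {f g : Code} {a b c : BinTree} : EvalsTo g a b → EvalsTo f b c →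
      EvalsTo (.comp f g) a c
  | case_zero {f g : Code} {a b : BinTree} : a.left = leaf → EvalsTo f a.right b →
      EvalsTo (.case f g) a b
  | case_succ {f g : Code} {a b x n : BinTree} : a.left = node x n →
      EvalsTo g (node n a.right) b → EvalsTo (.case f g) a b
  | fix_halt {f : Code} {a b : BinTree} : EvalsTo f a b → b.left = leaf →
      EvalsTo (.fix f) a b.right
  | fix_step {f : Code} {a b c x n : BinTree} : EvalsTo f a b → b.left = node x n →
      EvalsTo (.fix f) b.right c → EvalsTo (.fix f) a c

theorem ofNat_eq_leaf {n : ℕ} (h : ofNat n = leaf) : n = 0 := by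
  cases n <;> simp [ofNat] at h ⊢

theorem ofNat_eq_node {n : ℕ} {a b : BinTree} (h : ofNat n = node a b) :
    ∃ k, n = k + 1 ∧ b = ofNat k := by
  cases n with
  | zero => simp [ofNat] at h
  | succ k =>
    simp only [ofNat, node.injEq] at h
    exact ⟨k, rfl, h.2.symm⟩

/-- The rules act on all trees, because the relational axioms cannot single out encodings of lists.
On such encodings they never leave them, and leaf defaults match `headI` and `tail`, so each
derivation is a genuine computation. -/
theorem EvalsTo.exists_mem_eval {c : Code} {a b : BinTree} (h : EvalsTo c a b) :
    ∀ v : List ℕ, a = ofList v → ∃ w ∈ c.eval v, b = ofList w := by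
  induction h with
  | zero' a =>
    rintro v rfl
    exact ⟨0 :: v, by simp, rfl⟩
  | succ a =>
    rintro v rfl
    exact ⟨[v.headI.succ], by simp, by simp [ofList, ofNat, left_ofList]⟩
  | tail a =>
    rintro v rfl
    exact ⟨v.tail, by simp, right_ofList v⟩
  | cons _ _ ihf ihg =>
    intro v hv
    obtain ⟨w, hw, rfl⟩ := ihf v hv
    obtain ⟨u, hu, rfl⟩ := ihg v hv
    refine ⟨w.headI :: u, ?_, by rw [left_ofList]; rfl⟩
    simp only [Code.cons_eval, Part.bind_eq_bind, Part.mem_bind_iff]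
    exact ⟨w, hw, u, hu, by simp⟩
  | comp _ _ ihg ihf =>
    intro v hv
    obtain ⟨w, hw, rfl⟩ := ihg v hv
    obtain ⟨u, hu, rfl⟩ := ihf w rfl
    refine ⟨u, ?_, rfl⟩
    rw [Code.comp_eval]
    exact Part.mem_bind_iff.2 ⟨w, hw, hu⟩
  | case_zero h _ ih =>
    rintro v rfl
    rw [left_ofList] at h
    obtain ⟨w, hw, rfl⟩ := ih v.tail (right_ofList v)
    refine ⟨w, ?_, rfl⟩
    simp only [Code.case_eval, ofNat_eq_leaf h]
    exact hw
  | case_succ h _ ih =>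
    rintro v rfl
    rw [left_ofList] at h
    obtain ⟨k, hk, rfl⟩ := ofNat_eq_node h
    obtain ⟨w, hw, rfl⟩ := ih (k :: v.tail) (by rw [right_ofList]; rfl)
    refine ⟨w, ?_, rfl⟩
    simp only [Code.case_eval, hk]
    exact hw
  | fix_halt _ h ih =>
    intro v hv
    obtain ⟨w, hw, rfl⟩ := ih v hv
    rw [left_ofList] at h
    refine ⟨w.tail, ?_, right_ofList w⟩
    rw [Code.fix_eval]
    exact PFun.mem_fix_iff.2 <| Or.inl (Part.mem_map_iff _ |>.2 ⟨w, hw, if_pos (ofNat_eq_leaf h)⟩)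
  | fix_step _ h _ ih ih' =>
    intro v hv
    obtain ⟨w, hw, rfl⟩ := ih v hv
    rw [left_ofList] at h
    obtain ⟨k, hk, rfl⟩ := ofNat_eq_node h
    obtain ⟨u, hu, rfl⟩ := ih' w.tail (right_ofList w)
    refine ⟨u, ?_, rfl⟩
    rw [Code.fix_eval] at hu ⊢
    exact PFun.mem_fix_iff.2 <| Or.inr ⟨w.tail, Part.mem_map_iff _ |>.2 ⟨w, hw, if_neg (by omega)⟩, hu⟩

theorem evalsTo_of_mem_eval (c : Code) :
    ∀ v w : List ℕ, w ∈ c.eval v → EvalsTo c (ofList v) (ofList w) := by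
  induction c with
  | zero' =>
    intro v w h
    simp at h
    subst h
    exact .zero' _
  | succ =>
    intro v w h
    simp at h
    subst h
    have := EvalsTo.succ (ofList v)
    rwa [left_ofList] at this
  | tail =>
    intro v w h
    simp at h
    subst h
    rw [← right_ofList]
    exact .tail _
  | cons f g ihf ihg =>
    intro v w h
    simp only [Code.cons_eval, Part.bind_eq_bind, Part.mem_bind_iff] at h
    obtain ⟨x, hx, y, hy, h⟩ := h
    simp at h
    subst h
    have := EvalsTo.cons (ihf _ _ hx) (ihg _ _ hy)
    rwa [left_ofList] at this
  | comp f g ihf ihg =>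
    intro v w h
    rw [Code.comp_eval] at h
    obtain ⟨x, hx, h⟩ := Part.mem_bind_iff.1 h
    exact .comp (ihg _ _ hx) (ihf _ _ h)
  | case f g ihf ihg =>
    intro v w h
    simp only [Code.case_eval] at h
    cases hv : v.headI with
    | zero =>
      rw [hv] at h
      refine .case_zero (by rw [left_ofList, hv]; rfl) ?_
      rw [right_ofList]
      exact ihf _ _ h
    | succ n =>
      rw [hv] at h
      refine .case_succ (by rw [left_ofList, hv]; rfl) ?_
      rw [right_ofList]
      exact ihg _ _ h
  | fix f ih =>
    intro v w h
    rw [Code.fix_eval] at h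
    refine PFun.fixInduction' (C := fun v => EvalsTo (.fix f) (ofList v) (ofList w)) h ?_ ?_
    · intro u hu
      obtain ⟨x, hx, hxw⟩ := (Part.mem_map_iff _).1 hu
      split_ifs at hxw with hx0
      cases hxw
      rw [← right_ofList]
      exact .fix_halt (ih _ _ hx) (by rw [left_ofList, hx0]; rfl)
    · intro u u' _ hu hu'
      obtain ⟨x, hx, hxw⟩ := (Part.mem_map_iff _).1 hu
      split_ifs at hxw with hx0
      cases hxw
      rw [← right_ofList] at hu'
      obtain ⟨k, hk⟩ := Nat.exists_eq_succ_of_ne_zero hx0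
      exact .fix_step (ih _ _ hx) (by rw [left_ofList, hk]; rfl) hu'

theorem exists_evalsTo_iff (c : Code) (v : List ℕ) :
    (∃ b, EvalsTo c (ofList v) b) ↔ (c.eval v).Dom := by
  rw [Part.dom_iff_mem]
  constructor
  · rintro ⟨b, hb⟩
    obtain ⟨w, hw, -⟩ := hb.exists_mem_eval v rfl
    exact ⟨w, hw⟩
  · rintro ⟨w, hw⟩
    exact ⟨_, evalsTo_of_mem_eval c v w hw⟩

/-! ### Terms of the calculus of relations -/

/-- Terms of the calculus of relations (without converse) over the relation symbols `ι`. -/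
inductive RelTerm (ι : Type) : Type
  | sym (i : ι) : RelTerm ι
  | top : RelTerm ι
  | one : RelTerm ι
  | union (s t : RelTerm ι) : RelTerm ι
  | inter (s t : RelTerm ι) : RelTerm ι
  | diff (s t : RelTerm ι) : RelTerm ι
  | comp (s t : RelTerm ι) : RelTerm ι

/-- The value of a relation term. -/
def RelTerm.sem {ι : Type} {X : Type*} (R : ι → X → X → Prop) : RelTerm ι → X → X → Prop
  | sym i => R i
  | top => fun _ _ => True
  | one => fun a b => a = b
  | union s t => fun a b => s.sem R a b ∨ t.sem R a b
  | inter s t => fun a b => s.sem R a b ∧ t.sem R a b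
  | diff s t => fun a b => s.sem R a b ∧ ¬ t.sem R a b
  | comp s t => fun a b => ∃ c, s.sem R a c ∧ t.sem R c b

/-- Isomorphism invariance, used to move the tree model to another countably infinite set. -/
theorem RelTerm.sem_equiv {ι : Type} {X Y : Type*} (e : X ≃ Y) (R : ι → Y → Y → Prop)
    (t : RelTerm ι) (a b : X) :
    t.sem (fun i a b => R i (e a) (e b)) a b ↔ t.sem R (e a) (e b) := by
  induction t generalizing a b with
  | comp s t ihs iht =>
    simp only [sem, ihs, iht]
    exact ⟨fun ⟨c, h⟩ => ⟨e c, h⟩, fun ⟨c, h⟩ => ⟨e.symm c, by simpa using h⟩⟩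
  | _ => simp_all [sem]

/-! ### Axioms for trees and evaluation -/

/-- The relation symbols used to axiomatize evaluation: the leaf, the two projections of a node,
their converses, and the graph of every code. -/
inductive Sym : Type
  | leaf
  | left
  | mkLeft
  | right
  | mkRight
  | graph (c : Code)

/-- An injective numbering of the codes. -/
def codeToNat : Code → ℕ
  | .zero' => Nat.pair 0 0
  | .succ => Nat.pair 1 0
  | .tail => Nat.pair 2 0
  | .cons f g => Nat.pair 3 (Nat.pair (codeToNat f) (codeToNat g))
  | .comp f g => Nat.pair 4 (Nat.pair (codeToNat f) (codeToNat g))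
  | .case f g => Nat.pair 5 (Nat.pair (codeToNat f) (codeToNat g))
  | .fix f => Nat.pair 6 (codeToNat f)

theorem codeToNat_injective : Function.Injective codeToNat := by
  intro c
  induction c <;> intro d h <;> cases d <;> simp only [codeToNat, Nat.pair_eq_pair] at h <;> grind

/-- An injective numbering of the relation symbols. -/
def Sym.toNat : Sym → ℕ
  | leaf => 0
  | left => 1
  | mkLeft => 2
  | right => 3
  | mkRight => 4
  | graph c => codeToNat c + 5

theorem Sym.toNat_injective : Function.Injective Sym.toNat := by
  intro s t h
  cases s <;> cases t <;> simp only [toNat] at h <;> try omega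
  all_goals first | rfl | rw [codeToNat_injective (Nat.add_right_cancel h)]

namespace RelTerm

/-- Everything to the leaf. -/
def toLeaf : RelTerm Sym := comp top (inter (sym .leaf) one)

/-- The left projection, with default the leaf. -/
def leftD : RelTerm Sym := union (sym .left) (inter (sym .leaf) one)

/-- The right projection, with default the leaf. -/
def rightD : RelTerm Sym := union (sym .right) (inter (sym .leaf) one)

/-- The relation that maps `a` to the nodes with left part in `s a` and right part in `t a`. -/
def fork (s t : RelTerm Sym) : RelTerm Sym :=
  inter (comp s (sym .mkLeft)) (comp t (sym .mkRight))

/-- The points whose left projection is the leaf. -/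
def leftIsLeaf : RelTerm Sym := comp leftD (comp (inter (sym .leaf) one) top)

/-- The points whose left projection is a node. -/
def leftIsNode : RelTerm Sym := comp leftD (comp (sym .right) top)

/-- The violations of the axioms on trees. -/
def treeViolation : RelTerm Sym :=
  union (inter (comp (sym .mkLeft) (diff top (sym .left))) one)
    (union (inter (comp (sym .right) (diff top (sym .mkRight))) one)
      (diff top (comp (sym .mkLeft) (sym .right))))

/-- The violations of the evaluation rules for the subterms of a code. -/
def evalViolation : Code → RelTerm Sym
  | .zero' => diff (fork toLeaf one) (sym (.graph .zero'))
  | .succ => diff (fork (fork toLeaf leftD) toLeaf) (sym (.graph .succ))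
  | .tail => diff rightD (sym (.graph .tail))
  | .cons f g =>
    union (union (evalViolation f) (evalViolation g))
      (diff (fork (comp (sym (.graph f)) leftD) (sym (.graph g))) (sym (.graph (.cons f g))))
  | .comp f g =>
    union (union (evalViolation f) (evalViolation g))
      (diff (comp (sym (.graph g)) (sym (.graph f))) (sym (.graph (.comp f g))))
  | .case f g =>
    union (union (evalViolation f) (evalViolation g))
      (diff (union (inter leftIsLeaf (comp rightD (sym (.graph f))))
        (comp (fork (comp leftD (sym .right)) rightD) (sym (.graph g))))
        (sym (.graph (.case f g))))
  | .fix f =>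
    union (evalViolation f)
      (diff (comp (sym (.graph f)) (union (inter leftIsLeaf rightD)
        (comp (inter leftIsNode rightD) (sym (.graph (.fix f)))))) (sym (.graph (.fix f))))

/-- Everything to the tree of a natural number. -/
def toNumeral : ℕ → RelTerm Sym
  | 0 => toLeaf
  | n + 1 => fork toLeaf (toNumeral n)

/-- All axioms hold, and the code has no value on the given number. -/
def diverges (c : Code) (n : ℕ) : RelTerm Sym :=
  -- Composing with `top` on both sides turns a relation into the full one if it is nonempty and the
  -- empty one otherwise. So this term is full when a leaf exists and nothing is violated, and empty
  -- otherwise.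
  diff (comp top (comp (inter (sym .leaf) one) top))
    (comp top (comp (union (union treeViolation (evalViolation c))
      (comp (fork (toNumeral n) toLeaf) (sym (.graph c)))) top))

end RelTerm

open RelTerm

/-! ### The tree model -/

/-- The intended interpretation of the relation symbols in the binary trees. -/
def treeModel : Sym → BinTree → BinTree → Prop
  | .leaf => fun a b => a = leaf ∧ b = leaf
  | .left => fun p a => ∃ b, p = node a b
  | .mkLeft => fun a p => ∃ b, p = node a b
  | .right => fun p b => ∃ a, p = node a b
  | .mkRight => fun b p => ∃ a, p = node a b
  | .graph c => EvalsTo c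

theorem treeModel_toLeaf {a b : BinTree} : toLeaf.sem treeModel a b ↔ b = leaf := by
  simp [toLeaf, sem, treeModel]

theorem treeModel_leftD {a b : BinTree} : leftD.sem treeModel a b ↔ b = a.left := by
  cases a <;> simp [leftD, sem, treeModel, BinTree.left] <;> grind

theorem treeModel_rightD {a b : BinTree} : rightD.sem treeModel a b ↔ b = a.right := by
  cases a <;> simp [rightD, sem, treeModel, BinTree.right] <;> grind

theorem treeModel_fork {s t : RelTerm Sym} {a p : BinTree} :
    (fork s t).sem treeModel a p ↔
      ∃ x y, s.sem treeModel a x ∧ t.sem treeModel a y ∧ p = node x y := by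
  simp only [fork, sem, treeModel]
  constructor
  · rintro ⟨⟨x, hx, y, rfl⟩, y', hy, x', h⟩
    cases h
    exact ⟨x, y, hx, hy, rfl⟩
  · rintro ⟨x, y, hx, hy, rfl⟩
    exact ⟨⟨x, hx, y, rfl⟩, y, hy, x, rfl⟩

theorem treeModel_leftIsLeaf {a b : BinTree} :
    leftIsLeaf.sem treeModel a b ↔ a.left = leaf := by
  simp only [leftIsLeaf, sem, treeModel_leftD]
  simp [treeModel]

theorem treeModel_leftIsNode {a b : BinTree} :
    leftIsNode.sem treeModel a b ↔ ∃ x n, a.left = node x n := by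
  simp only [leftIsNode, sem, treeModel_leftD]
  simp [treeModel]
  grind

theorem treeModel_toNumeral {n : ℕ} {a b : BinTree} :
    (toNumeral n).sem treeModel a b ↔ b = ofNat n := by
  induction n generalizing b with
  | zero => exact treeModel_toLeaf
  | succ n ih => simp [toNumeral, treeModel_fork, treeModel_toLeaf, ih, ofNat]

theorem treeModel_treeViolation (a b : BinTree) : ¬ treeViolation.sem treeModel a b := by
  simp only [treeViolation, sem, treeModel]
  rintro (⟨⟨p, ⟨y, rfl⟩, -, h⟩, rfl⟩ | ⟨⟨p, ⟨y, rfl⟩, -, h⟩, rfl⟩ | ⟨-, h⟩)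
  · exact h ⟨_, rfl⟩
  · exact h ⟨_, rfl⟩
  · exact h ⟨node a b, ⟨_, rfl⟩, _, rfl⟩

/-- `EvalsTo` is closed under its own rules, and each disjunct of a violation would refute one rule.
-/
theorem treeModel_evalViolation (c : Code) (a b : BinTree) :
    ¬ (evalViolation c).sem treeModel a b := by
  induction c generalizing a b with
  | zero' =>
    simp only [evalViolation, sem, treeModel_fork, treeModel_toLeaf]
    rintro ⟨⟨_, _, rfl, rfl, rfl⟩, h⟩
    exact h (.zero' _)
  | succ =>
    simp only [evalViolation, sem, treeModel_fork, treeModel_toLeaf, treeModel_leftD]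
    rintro ⟨⟨_, _, ⟨_, _, rfl, rfl, rfl⟩, rfl, rfl⟩, h⟩
    exact h (.succ _)
  | tail =>
    simp only [evalViolation, sem, treeModel_rightD]
    rintro ⟨rfl, h⟩
    exact h (.tail _)
  | cons f g ihf ihg =>
    simp only [evalViolation, sem, treeModel_fork, treeModel_leftD]
    rintro ((h | h) | ⟨⟨_, y, ⟨x, hx, rfl⟩, hy, rfl⟩, h⟩)
    · exact ihf _ _ h
    · exact ihg _ _ h
    · exact h (.cons hx hy)
  | comp f g ihf ihg =>
    simp only [evalViolation, sem]
    rintro ((h | h) | ⟨⟨x, hx, hy⟩, h⟩)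
    · exact ihf _ _ h
    · exact ihg _ _ h
    · exact h (.comp hx hy)
  | case f g ihf ihg =>
    simp only [evalViolation, sem, treeModel_fork, treeModel_leftD, treeModel_rightD,
      treeModel_leftIsLeaf]
    rintro ((h | h) | ⟨⟨h0, _, rfl, hx⟩ | ⟨_, ⟨n, _, ⟨_, rfl, x, hn⟩, rfl, rfl⟩, hx⟩, h⟩)
    · exact ihf _ _ h
    · exact ihg _ _ h
    · exact h (.case_zero h0 hx)
    · exact h (.case_succ hn hx)
  | fix f ih =>
    simp only [evalViolation, sem, treeModel_rightD, treeModel_leftIsLeaf, treeModel_leftIsNode]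
    rintro (h | ⟨⟨x, hx, ⟨h0, rfl⟩ | ⟨_, ⟨⟨_, _, hn⟩, rfl⟩, hy⟩⟩, h⟩)
    · exact ih _ _ h
    · exact h (.fix_halt hx h0)
    · exact h (.fix_step hx hn hy)

theorem treeModel_diverges (c : Code) (n : ℕ) (h : ¬ (c.eval [n]).Dom) (a b : BinTree) :
    (diverges c n).sem treeModel a b := by
  refine ⟨⟨leaf, trivial, leaf, ⟨⟨rfl, rfl⟩, rfl⟩, trivial⟩, ?_⟩
  rintro ⟨x, -, y, ((hv | hv) | ⟨z, hz, hv⟩), -⟩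
  · exact treeModel_treeViolation _ _ hv
  · exact treeModel_evalViolation _ _ _ hv
  · rw [treeModel_fork] at hz
    obtain ⟨_, _, hm, hl, rfl⟩ := hz
    rw [treeModel_toNumeral] at hm
    rw [treeModel_toLeaf] at hl
    subst hm hl
    exact h ((exists_evalsTo_iff c [n]).1 ⟨_, hv⟩)

/-! ### Trees in an arbitrary model of the axioms -/

section Model

variable {X : Type*} {R : Sym → X → X → Prop}

/-- An image of the binary trees in an interpretation of the relation symbols. -/
structure TreeImage (R : Sym → X → X → Prop) (e : BinTree → X) : Prop where
  leaf : R .leaf (e leaf) (e leaf)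
  left (a b : BinTree) : R .left (e (node a b)) (e a)
  mkLeft (a b : BinTree) : R .mkLeft (e a) (e (node a b))
  right (a b : BinTree) : R .right (e (node a b)) (e b)
  mkRight (a b : BinTree) : R .mkRight (e b) (e (node a b))

/-- Choose a pair for any two points and recurse from the leaf. The other axioms supply the converse
directions, since converse is not an operation. -/
theorem exists_treeImage {z : X} (hz : R .leaf z z)
    (hR : ∀ a b, ¬ treeViolation.sem R a b) : ∃ e, TreeImage R e := by
  simp only [treeViolation, sem] at hR
  have hl : ∀ a p, R .mkLeft a p → R .left p a := fun a p h => by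
    by_contra h'
    exact hR a a (.inl ⟨⟨p, h, trivial, h'⟩, rfl⟩)
  have hr : ∀ p b, R .right p b → R .mkRight b p := fun p b h => by
    by_contra h'
    exact hR p p (.inr (.inl ⟨⟨b, h, trivial, h'⟩, rfl⟩))
  have hn : ∀ a b, ∃ p, R .mkLeft a p ∧ R .right p b := fun a b => by
    by_contra h'
    exact hR a b (.inr (.inr ⟨trivial, h'⟩))
  choose mk hmk using hn
  let e : BinTree → X := fun t => BinTree.rec z (fun _ _ x y => mk x y) t
  exact ⟨e, hz, fun a b => hl _ _ (hmk _ _).1, fun a b => (hmk _ _).1, fun a b => (hmk _ _).2,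
    fun a b => hr _ _ (hmk _ _).2⟩

namespace TreeImage

variable {e : BinTree → X}

theorem sem_toLeaf (h : TreeImage R e) (x : X) : toLeaf.sem R x (e BinTree.leaf) :=
  ⟨_, trivial, h.leaf, rfl⟩

theorem sem_leftD (h : TreeImage R e) (a : BinTree) : leftD.sem R (e a) (e a.left) := by
  cases a with
  | leaf => exact .inr ⟨h.leaf, rfl⟩
  | node a b => exact .inl (h.left a b)

theorem sem_rightD (h : TreeImage R e) (a : BinTree) : rightD.sem R (e a) (e a.right) := by
  cases a with
  | leaf => exact .inr ⟨h.leaf, rfl⟩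
  | node a b => exact .inl (h.right a b)

theorem sem_fork (h : TreeImage R e) {s t : RelTerm Sym} {x : X} {a b : BinTree}
    (hs : s.sem R x (e a)) (ht : t.sem R x (e b)) : (fork s t).sem R x (e (node a b)) :=
  ⟨⟨_, hs, h.mkLeft a b⟩, _, ht, h.mkRight a b⟩

theorem sem_leftIsLeaf (h : TreeImage R e) {a : BinTree} (ha : a.left = BinTree.leaf) (x : X) :
    leftIsLeaf.sem R (e a) x :=
  ⟨_, h.sem_leftD a, e BinTree.leaf, ⟨by rw [ha]; exact h.leaf, by rw [ha]; rfl⟩, trivial⟩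

theorem sem_leftIsNode (h : TreeImage R e) {a b n : BinTree} (ha : a.left = node b n) (x : X) :
    leftIsNode.sem R (e a) x :=
  ⟨_, h.sem_leftD a, e n, by rw [ha]; exact h.right b n, trivial⟩

theorem sem_toNumeral (h : TreeImage R e) (n : ℕ) (x : X) :
    (toNumeral n).sem R x (e (ofNat n)) := by
  induction n with
  | zero => exact h.sem_toLeaf x
  | succ n ih => exact h.sem_fork (h.sem_toLeaf x) ih

/-- Induction on the derivation: only closure of the graphs under the rules is needed, so `R` may
contain spurious evaluations. -/
theorem graph (h : TreeImage R e) {c : Code} {a b : BinTree} (hab : EvalsTo c a b)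
    (hR : ∀ x y, ¬ (evalViolation c).sem R x y) : R (.graph c) (e a) (e b) := by
  induction hab with
  | zero' a =>
    by_contra hg
    exact hR _ _ ⟨h.sem_fork (h.sem_toLeaf _) rfl, hg⟩
  | succ a =>
    by_contra hg
    exact hR _ _ ⟨h.sem_fork (h.sem_fork (h.sem_toLeaf _) (h.sem_leftD _)) (h.sem_toLeaf _), hg⟩
  | tail a =>
    by_contra hg
    exact hR _ _ ⟨h.sem_rightD _, hg⟩
  | @cons f g a b c _ _ ihf ihg =>
    have hf := ihf fun x y hv => hR x y (.inl (.inl hv))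
    have hg := ihg fun x y hv => hR x y (.inl (.inr hv))
    by_contra hc
    exact hR _ _ (.inr ⟨h.sem_fork ⟨_, hf, h.sem_leftD _⟩ hg, hc⟩)
  | comp _ _ ihg ihf =>
    have hf := ihf fun x y hv => hR x y (.inl (.inl hv))
    have hg := ihg fun x y hv => hR x y (.inl (.inr hv))
    by_contra hc
    exact hR _ _ (.inr ⟨⟨_, hg, hf⟩, hc⟩)
  | case_zero h0 _ ih =>
    have hf := ih fun x y hv => hR x y (.inl (.inl hv))
    by_contra hc
    exact hR _ _ (.inr ⟨.inl ⟨h.sem_leftIsLeaf h0 _, _, h.sem_rightD _, hf⟩, hc⟩)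
  | @case_succ f g a b x n hn _ ih =>
    have hg := ih fun x y hv => hR x y (.inl (.inr hv))
    by_contra hc
    refine hR _ _ (.inr ⟨.inr ⟨_, h.sem_fork ⟨_, h.sem_leftD _, ?_⟩ (h.sem_rightD _), hg⟩, hc⟩)
    rw [hn]
    exact h.right x n
  | fix_halt _ h0 ih =>
    have hf := ih fun x y hv => hR x y (.inl hv)
    by_contra hc
    exact hR _ _ (.inr ⟨⟨_, hf, .inl ⟨h.sem_leftIsLeaf h0 _, h.sem_rightD _⟩⟩, hc⟩)
  | fix_step _ hn _ ih ih' =>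
    have hf := ih fun x y hv => hR x y (.inl hv)
    have hg := ih' hR
    by_contra hc
    exact hR _ _
      (.inr ⟨⟨_, hf, .inr ⟨_, ⟨h.sem_leftIsNode hn _, h.sem_rightD _⟩, hg⟩⟩, hc⟩)

end TreeImage

theorem not_dom_of_sem_diverges {c : Code} {n : ℕ} {x y : X} (h : (diverges c n).sem R x y) :
    ¬ (c.eval [n]).Dom := by
  obtain ⟨⟨z, -, z', ⟨hz, hzz⟩, -⟩, hR⟩ := h
  have hR' : ∀ a b, ¬ (union (union treeViolation (evalViolation c))
      (comp (fork (toNumeral n) toLeaf) (sym (.graph c)))).sem R a b :=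
    fun a b hab => hR ⟨a, trivial, b, hab, trivial⟩
  cases (hzz : z = z')
  obtain ⟨e, he⟩ := exists_treeImage hz fun a b hab => hR' a b (.inl (.inl hab))
  rw [← exists_evalsTo_iff]
  rintro ⟨t, ht⟩
  exact hR' x _ (.inr ⟨_, he.sem_fork (he.sem_toNumeral n x) (he.sem_toLeaf x),
    he.graph ht fun a b hab => hR' a b (.inl (.inr hab))⟩)

theorem exists_sem_diverges_iff (X : Type*) [Countable X] [Infinite X] (c : Code) (n : ℕ) :
    (∃ R : Sym → X → X → Prop, ∃ x y, (diverges c n).sem R x y) ↔ ¬ (c.eval [n]).Dom := by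
  refine ⟨fun ⟨R, x, y, h⟩ => not_dom_of_sem_diverges h, fun h => ?_⟩
  obtain ⟨e⟩ := nonempty_equiv_of_countable (α := X) (β := BinTree)
  exact ⟨fun i a b => treeModel i (e a) (e b), e.symm leaf, e.symm leaf,
    (RelTerm.sem_equiv e treeModel _ _ _).2 (treeModel_diverges c n h _ _)⟩

end Model

/-- There is a code whose halting set is not computable. -/
theorem exists_code_not_computablePred :
    ∃ c : Code, ¬ ComputablePred fun n : ℕ => (c.eval [n]).Dom := by
  -- A universal machine: program number `n` is run on input 0.
  have hp : Partrec fun n : ℕ => (Denumerable.ofNat Nat.Partrec.Code n).eval 0 :=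
    Nat.Partrec.Code.eval_part.comp (Computable.ofNat _) (Computable.const 0)
  obtain ⟨c, hc⟩ := Code.exists_code (Nat.Partrec'.part_iff₁.2 hp)
  refine ⟨c, fun h => ComputablePred.halting_problem 0 ?_⟩
  obtain ⟨f, hf, hfc⟩ := ComputablePred.computable_iff.1 h
  refine ComputablePred.computable_iff.2
    ⟨fun d => f (Encodable.encode d), hf.comp Computable.encode, funext fun d => ?_⟩
  rw [← congrFun hfc]
  have := hc ⟨[Encodable.encode d], rfl⟩
  simp only [List.Vector.head] at this
  simp [this]

/-! ### Translation into LIF expressions -/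

section Translation

variable {S : Vocabulary} {V : Type*} {dom : Type*} {ι : Type}

/-- The relation on valuations that relates the values of `x` by `r` and allows the variables in
`Z` to change. -/
def BRV.lift (Z : Finset V) (x : V) (r : dom → dom → Prop) : BRV V dom :=
  {p | r (p.1 x) (p.2 x) ∧ AgreeOutside p.1 p.2 (Z : Set V)}

/-- All pairs of valuations that agree outside `Z`. -/
def Expr.top (Z : Finset V) : Expr S V := .cylR Z .id

theorem Expr.sem_top (D : Interpretation S dom) (Z : Finset V) :
    (Expr.top Z : Expr S V).sem D = {p | AgreeOutside p.1 p.2 (Z : Set V)} := by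
  ext p
  constructor
  · rintro ⟨ν, hν : p.1 = ν, h⟩
    subst hν
    exact h
  · intro h
    exact ⟨p.1, rfl, h⟩

/-- The translation of relation terms into expressions, given expressions for the relation
symbols. -/
def RelTerm.toExpr (Z : Finset V) (x : V) (b : ι → Expr S V) : RelTerm ι → Expr S V
  | sym i => b i
  | top => .top Z
  | one => .selLR x x (.top Z)
  | union s t => .union (s.toExpr Z x b) (t.toExpr Z x b)
  | inter s t => .inter (s.toExpr Z x b) (t.toExpr Z x b)
  | diff s t => .diff (s.toExpr Z x b) (t.toExpr Z x b)
  | comp s t => .comp (s.toExpr Z x b) (t.toExpr Z x b)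

theorem RelTerm.sem_toExpr {D : Interpretation S dom} {Z : Finset V} {x : V} (hx : x ∈ Z)
    {b : ι → Expr S V} {R : ι → dom → dom → Prop} (hb : ∀ i, (b i).sem D = BRV.lift Z x (R i))
    (t : RelTerm ι) : (t.toExpr Z x b).sem D = BRV.lift Z x (t.sem R) := by
  classical
  induction t with
  | sym i => exact hb i
  | top => simp [toExpr, Expr.sem_top, BRV.lift, sem]
  | one =>
    ext p
    simp [toExpr, Expr.sem, Expr.sem_top, BRV.lift, sem, BRV.selLR, and_comm]
  | union s t ihs iht =>
    ext p
    simp only [toExpr, Expr.sem, ihs, iht, BRV.lift, sem, Set.mem_union, Set.mem_ofPred_eq]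
    tauto
  | inter s t ihs iht =>
    ext p
    simp only [toExpr, Expr.sem, ihs, iht, BRV.lift, sem, Set.mem_inter_iff, Set.mem_ofPred_eq]
    tauto
  | diff s t ihs iht =>
    ext p
    simp only [toExpr, Expr.sem, ihs, iht, BRV.lift, sem, Set.mem_sdiff, Set.mem_ofPred_eq]
    tauto
  | comp s t ihs iht =>
    ext p
    simp only [toExpr, Expr.sem, ihs, iht, BRV.lift, sem, BRV.comp, Set.mem_ofPred_eq]
    constructor
    · rintro ⟨ν, ⟨h₁, h₁'⟩, h₂, h₂'⟩
      exact ⟨⟨_, h₁, h₂⟩, fun y hy => (h₁' y hy).trans (h₂' y hy)⟩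
    · rintro ⟨⟨a, h₁, h₂⟩, h⟩
      have hne : ∀ y, y ∉ (Z : Set V) → y ≠ x := fun y hy hyx => hy (hyx ▸ hx)
      -- The intermediate point `a` is stored in `x`, which may change because `x ∈ Z`.
      refine ⟨Function.update p.1 x a, ⟨by simpa using h₁, fun y hy => ?_⟩, by simpa using h₂,
        fun y hy => ?_⟩
      · simp [hne y hy]
      · simpa [hne y hy] using h y hy

theorem BRV.lift_nonempty_iff {Z : Finset V} {x : V} (hx : x ∈ Z) {r : dom → dom → Prop} :
    (BRV.lift Z x r).Nonempty ↔ ∃ a b, r a b := by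
  classical
  constructor
  · rintro ⟨p, hp, -⟩
    exact ⟨_, _, hp⟩
  · rintro ⟨a, b, h⟩
    refine ⟨(fun _ => a, Function.update (fun _ => a) x b), by simpa using h, fun y hy => ?_⟩
    have : y ≠ x := fun hyx => hy (hyx ▸ hx)
    simp [this]

/-- A family of expressions that denote exactly the arbitrary families of binary relations on the
values of `x`. -/
def Expr.DenotesRelations (dom : Type*) (Z : Finset V) (x : V) (b : ι → Expr S V) : Prop :=
  (∀ R : ι → dom → dom → Prop, ∃ D : Interpretation S dom,
    ∀ i, (b i).sem D = BRV.lift Z x (R i)) ∧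
  ∀ D : Interpretation S dom, ∃ R : ι → dom → dom → Prop, ∀ i, (b i).sem D = BRV.lift Z x (R i)

theorem RelTerm.satisfiable_toExpr_iff {Z : Finset V} {x : V} (hx : x ∈ Z) {b : ι → Expr S V}
    (hb : Expr.DenotesRelations dom Z x b) (t : RelTerm ι) :
    (t.toExpr Z x b).Satisfiable dom ↔ ∃ R : ι → dom → dom → Prop, ∃ a c, t.sem R a c := by
  constructor
  · rintro ⟨D, hD⟩
    obtain ⟨R, hR⟩ := hb.2 D
    rw [sem_toExpr hx hR, BRV.lift_nonempty_iff hx] at hD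
    exact ⟨R, hD⟩
  · rintro ⟨R, hR⟩
    obtain ⟨D, hD⟩ := hb.1 R
    refine ⟨D, ?_⟩
    rwa [sem_toExpr hx hD, BRV.lift_nonempty_iff hx]

/-- For fixed `c` only the numeral depends on `n`. All other subexpressions have constant codes, so
`b` need not be computable. -/
theorem computable_code_diverges [Encodable S.Names] [Encodable V] (Z : Finset V) (x : V)
    (b : Sym → Expr S V) (c : Code) :
    Computable fun n => ((diverges c n).toExpr Z x b).code := by
  have hnum : Primrec fun n => ((toNumeral n).toExpr Z x b).code := by
    -- A successor numeral is a `fork`; tags 3 and 5 are those of `inter` and `comp`.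
    have : Primrec fun n : ℕ => Nat.rec (motive := fun _ => ℕ) (toLeaf.toExpr Z x b).code
        (fun _ k => Nat.pair 3 (Nat.pair
          ((RelTerm.comp toLeaf (sym .mkLeft)).toExpr Z x b).code
          (Nat.pair 5 (Nat.pair k (b .mkRight).code)))) n := by
      refine Primrec.nat_rec₁ _ (Primrec₂.natPair.comp (Primrec.const 3)
        (Primrec₂.natPair.comp (Primrec.const _)
          (Primrec₂.natPair.comp (Primrec.const 5)
            (Primrec₂.natPair.comp Primrec.snd (Primrec.const _)))))
    refine this.of_eq fun n => ?_
    induction n with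
    | zero => rfl
    | succ n ih =>
      simp only [ih]
      rfl
  have pr {f g : ℕ → ℕ} (hf : Primrec f) (hg : Primrec g) :
      Primrec fun n => Nat.pair (f n) (g n) := Primrec₂.natPair.comp hf hg
  have hin : Primrec fun n => ((fork (toNumeral n) toLeaf).toExpr Z x b).code :=
    pr (Primrec.const 3) (pr (pr (Primrec.const 5) (pr hnum (Primrec.const _))) (Primrec.const _))
  exact (pr (Primrec.const 4) (pr (Primrec.const _) (pr (Primrec.const 5) (pr (Primrec.const _)
    (pr (Primrec.const 5) (pr (pr (Primrec.const 2) (pr (Primrec.const _)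
      (pr (Primrec.const 5) (pr hin (Primrec.const _))))) (Primrec.const _))))))).to_comp

theorem not_satisfiabilityDecidable [Countable dom] [Infinite dom] [Encodable S.Names]
    [Encodable V] {Z : Finset V} {x : V} (hx : x ∈ Z) {b : Sym → Expr S V}
    (hb : Expr.DenotesRelations dom Z x b) : ¬ SatisfiabilityDecidable dom S V := by
  rintro ⟨f, hf, hfs⟩
  obtain ⟨c, hc⟩ := exists_code_not_computablePred
  have hcomp : Computable fun n => f ((diverges c n).toExpr Z x b).code :=
    hf.comp (computable_code_diverges Z x b c)
  refine hc ?_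
  have hnot : ComputablePred fun n : ℕ => ¬ (c.eval [n]).Dom := by
    refine ComputablePred.computable_iff.2 ⟨_, hcomp, funext fun n => propext ?_⟩
    rw [hfs, satisfiable_toExpr_iff hx hb, exists_sem_diverges_iff]
  exact hnot.not.of_eq fun n => not_not

/-- The atom `M(x;x)` reads its input on the left and its output on the right, so it is already an
arbitrary relation between old and new values of `x`. -/
theorem denotesRelations_of_iar_eq_one {f : ι → S.Names} (hf : Function.Injective f)
    (ha : ∀ i, S.arity (f i) = 2 ∧ S.iar (f i) = 1) (x : V) :
    Expr.DenotesRelations dom {x} x fun i => .atom (f i) fun _ => x := by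
  have key : ∀ (D : Interpretation S dom) (i : ι),
      (Expr.atom (f i) fun _ => x : Expr S V).sem D = BRV.lift {x} x fun a c =>
        (fun j : Fin (S.arity (f i)) => if (j : ℕ) < S.iar (f i) then a else c) ∈ D (f i) := by
    intro D i
    have : {y | ∃ j : Fin (S.arity (f i)), S.iar (f i) ≤ (j : ℕ) ∧ x = y} =
        (({x} : Finset V) : Set V) := by
      ext y
      simp only [Set.mem_ofPred_eq, Finset.coe_singleton, Set.mem_singleton_iff]
      constructor
      · rintro ⟨_, _, rfl⟩
        rfl
      · rintro rfl
        exact ⟨⟨1, by rw [(ha i).1]; norm_num⟩, (ha i).2.le, rfl⟩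
    simp only [Expr.sem, Expr.atomSem, this]
    rfl
  -- Each module gets the relation of its preimage under `f`, unique by injectivity; modules outside
  -- the range are empty.
  refine ⟨fun R => ⟨fun M => {t | ∃ i a c, f i = M ∧ R i a c ∧
    t = fun j : Fin (S.arity M) => if (j : ℕ) < S.iar M then a else c}, fun i => ?_⟩, fun D => ⟨_, key D⟩⟩
  refine (key _ i).trans (congrArg _ ?_)
  ext a c
  constructor
  · rintro ⟨i', a', c', hi, h, heq⟩
    cases hf hi
    have h0 := congrFun heq ⟨0, by rw [(ha i).1]; norm_num⟩
    have h1 := congrFun heq ⟨1, by rw [(ha i).1]; norm_num⟩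
    simp only [(ha i).2] at h0 h1
    simp at h0 h1
    rwa [h0, h1]
  · intro h
    exact ⟨i, a, c, rfl, h, rfl⟩

/-- The expression that relates the values of `x` by the binary module `M`, with `y` as auxiliary
variable. -/
def Expr.binary [DecidableEq V] (x y : V) (M : S.Names) : Expr S V :=
  .comp (.selLR x x (.top {x, y}))
    (.comp (.inter .id (.atom M fun i => if (i : ℕ) = 0 then x else y))
      (.selLR y x (.top {x, y})))

/-- Intersecting an atom with `id` makes it a test on a single valuation, where the input arity is
irrelevant. So: guess a value in `y`, test `M` on `x` and `y`, then move `y` into `x` and forget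
`y`. -/
theorem denotesRelations_binary [DecidableEq V] {f : ι → S.Names} (hf : Function.Injective f)
    (ha : ∀ i, S.arity (f i) = 2) {x y : V} (hxy : x ≠ y) :
    Expr.DenotesRelations dom {x, y} x fun i => Expr.binary x y (f i) := by
  have key : ∀ (D : Interpretation S dom) (i : ι),
      (Expr.binary x y (f i)).sem D = BRV.lift {x, y} x fun a c =>
        (fun j : Fin (S.arity (f i)) => if (j : ℕ) = 0 then a else c) ∈ D (f i) := by
    intro D i
    ext ⟨ν₁, ν₂⟩
    simp only [Expr.binary, Expr.sem, Expr.sem_top, BRV.comp, BRV.selLR, BRV.lift, Expr.atomSem,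
      Set.mem_ofPred_eq, Set.mem_inter_iff]
    constructor
    · rintro ⟨ν, ⟨h₁, hx⟩, _, ⟨rfl, h, -⟩, h₂, hy⟩
      refine ⟨?_, fun z hz => (h₁ z hz).trans (h₂ z hz)⟩
      rw [hx, ← hy]
      simpa only [ite_self, apply_ite ν] using h
    · rintro ⟨h, hag⟩
      have hne : ∀ z, z ∉ ((({x, y} : Finset V)) : Set V) → z ≠ y := fun z hz hzy => by
        simp [hzy] at hz
      have hνx : Function.update ν₁ y (ν₂ x) x = ν₁ x := by simp [hxy]
      have hνy : Function.update ν₁ y (ν₂ x) y = ν₂ x := by simp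
      -- The guess for `y` is the final value of `x`.
      refine ⟨Function.update ν₁ y (ν₂ x), ⟨fun z hz => by simp [hne z hz], hνx.symm⟩, _,
        ⟨rfl, ?_, fun _ _ => rfl⟩, fun z hz => by simpa [hne z hz] using hag z hz, hνy⟩
      simpa only [ite_self, apply_ite (Function.update ν₁ y (ν₂ x)), hνx, hνy] using h
  refine ⟨fun R => ⟨fun M => {t | ∃ i a c, f i = M ∧ R i a c ∧
    t = fun j : Fin (S.arity M) => if (j : ℕ) = 0 then a else c}, fun i => ?_⟩, fun D => ⟨_, key D⟩⟩
  refine (key _ i).trans (congrArg _ ?_)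
  ext a c
  constructor
  · rintro ⟨i', a', c', hi, h, heq⟩
    cases hf hi
    have h0 := congrFun heq ⟨0, by rw [ha i]; norm_num⟩
    have h1 := congrFun heq ⟨1, by rw [ha i]; norm_num⟩
    simp at h0 h1
    rwa [h0, h1]
  · intro h
    exact ⟨i, a, c, rfl, h, rfl⟩

end Translation

theorem exists_injective_sym {α : Type*} {s : Set α} (hs : s.Infinite) :
    ∃ f : Sym → α, Function.Injective f ∧ ∀ i, f i ∈ s :=
  ⟨fun i => hs.natEmbedding s i.toNat, fun _ _ h =>
    Sym.toNat_injective ((hs.natEmbedding s).injective (Subtype.ext h)), fun _ => Subtype.prop _⟩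

end LIF

theorem mainTheorem11 (dom : Type*) [Countable dom] [Infinite dom]
    (S : LIF.Vocabulary) [Encodable S.Names] (V : Type*) [Encodable V] :
    (Nonempty V → (∀ a i : ℕ, i ≤ a → {M : S.Names | S.arity M = a ∧ S.iar M = i}.Infinite) →
      ¬ LIF.SatisfiabilityDecidable dom S V) ∧
    (Nontrivial V → (∀ a : ℕ, {M : S.Names | S.arity M = a}.Infinite) →
      ¬ LIF.SatisfiabilityDecidable dom S V) := by
  classical
  constructor
  · rintro ⟨x⟩ h
    -- Only binary modules with one input are used.
    obtain ⟨f, hf, ha⟩ := LIF.exists_injective_sym (h 2 1 one_le_two)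
    exact LIF.not_satisfiabilityDecidable (Finset.mem_singleton_self x)
      (LIF.denotesRelations_of_iar_eq_one hf ha x)
  · rintro ⟨x, y, hxy⟩ h
    obtain ⟨f, hf, ha⟩ := LIF.exists_injective_sym (h 2)
    exact LIF.not_satisfiabilityDecidable (Finset.mem_insert_self x {y})
      (LIF.denotesRelations_binary hf ha hxy)
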